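/- Let $F$ be a finite field with $q$ elements, let $\chi:F\to\mathbb C^{\times}$ be a nontrivial additive character (for $q$ prime one may take $\chi(j)=e^{2\pi i j/q}$), and let $n=2k+1\ge 5$ be odd. A (not necessarily normalized) state of $n$ qudits of local dimension $q$ is a vector in $(\mathbb C^{q})^{\otimes n}$, with computational basis $|v_1,\dots,v_n\rangle$, $v_i\in F$. Let $X^{a}|j\rangle=|j+a\rangle$ and $Z^{a}|j\rangle=\chi(aj)|j\rangle$ for $a,j\in F$. Let $C\subseteq F^{n}$ be a linear MDS code of dimension $k$, i.e. with minimum distance $n-k+1$, and let $D\subseteq F^2$ be a linear MDS code of dimension $1$ (for instance $D=\{(\alpha,\alpha)\}$). Put $$|\phi_{n,0}\rangle=\sum_{c\in C}|c\rangle ,\qquad |\phi_{2,0}\rangle=\sum_{d\in D}|d\rangle ,\qquad |\phi_{n,2}\rangle=\bigl(\mathbb 1^{(n-2)}\otimes\mathcal O_2\bigr)|\phi_{n,0}\rangle ,$$ where $\mathcal O_2$ is the linear operator on the last two qudits given by $\mathcal O_2|i_1,i_2\rangle=(Z^{-i_1}\otimes X^{i_2})|\phi_{2,0}\rangle$. Then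 $|\phi_{n,0}\rangle$ and $|\phi_{n,2}\rangle$ are both absolutely maximally entangled (they are nonzero and all their reduced density matrices on at most $\lfloor n/2\rfloor=k$ qudits are proportional to the identity), and they are not SLOCC-equivalent: there are no invertible $q\times q$ complex matrices $M_1,\dots,M_n$ with $(M_1\otimes\cdots\otimes M_n)|\phi_{n,0}\rangle=|\phi_{n,2}\rangle$. -/

import Mathlib

open scoped BigOperators

noncomputable section

/-- Pure (unnormalized) states of `n` qudits whose computational basis is labelled by `F`
(so the local dimension is `q = |F|`): `ψ v` is the coefficient of `|v₁, …, vₙ⟩`. -/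
abbrev QState (F : Type*) (n : ℕ) : Type _ := (Fin n → F) → ℂ

/-- The action of `M₁ ⊗ ⋯ ⊗ Mₙ` on a state of `n` qudits. -/
def localAct {F : Type*} [Fintype F] {n : ℕ} (M : Fin n → Matrix F F ℂ) (ψ : QState F n) :
    QState F n :=
  fun v => ∑ w : Fin n → F, (∏ i, M i (v i) (w i)) * ψ w

/-- SLOCC equivalence: conversion by invertible local operators. A global scalar can be
absorbed in one of the factors as soon as `n ≥ 1`. -/
def SLOCCEquiv {F : Type*} [Fintype F] [DecidableEq F] {n : ℕ} (ψ φ : QState F n) : Prop :=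
  ∃ M : Fin n → Matrix F F ℂ, (∀ i, IsUnit (M i)) ∧ localAct M ψ = φ

/-- The reduced density matrix `ρ_S = Tr_{Sᶜ} |ψ⟩⟨ψ|` on the qudits in `S`. -/
def reducedDensity {F : Type*} [Fintype F] {n : ℕ} (ψ : QState F n) (S : Finset (Fin n)) :
    Matrix ({i // i ∈ S} → F) ({i // i ∈ S} → F) ℂ :=
  Matrix.of fun a b => ∑ w : {i // ¬ i ∈ S} → F,
    ψ ((Equiv.piEquivPiSubtypeProd (fun i => i ∈ S) (fun _ => F)).symm (a, w)) *
      starRingEnd ℂ (ψ ((Equiv.piEquivPiSubtypeProd (fun i => i ∈ S) (fun _ => F)).symm (b, w)))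

/-- `k`-uniform states: nonzero, and all reductions to at most `k` qudits are maximally mixed. -/
def IsKUniform {F : Type*} [Fintype F] [DecidableEq F] {n : ℕ} (k : ℕ) (ψ : QState F n) : Prop :=
  ψ ≠ 0 ∧ ∀ S : Finset (Fin n), S.card ≤ k → ∃ c : ℂ, reducedDensity ψ S = c • 1

/-- Absolutely maximally entangled states. -/
def IsAME {F : Type*} [Fintype F] [DecidableEq F] {n : ℕ} (ψ : QState F n) : Prop :=
  IsKUniform (n / 2) ψ

/-- `C` is a linear MDS code `[n, k, n - k + 1]` over `F`. -/
def IsMDSCode {F : Type*} [Field F] [DecidableEq F] {n : ℕ} (k : ℕ)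
    (C : Submodule F (Fin n → F)) : Prop :=
  Module.finrank F C = k ∧ ∀ c ∈ C, ∀ c' ∈ C, c ≠ c' → n + 1 ≤ hammingDist c c' + k

/-- The code state `|φ_{n,0}⟩ = ∑_{c ∈ C} |c⟩`. -/
def codeState {F : Type*} [Field F] {n : ℕ} (C : Submodule F (Fin n → F)) : QState F n :=
  Set.indicator (C : Set (Fin n → F)) (fun _ => 1)

/-- The generalized Pauli operator `X^a : |j⟩ ↦ |j + a⟩`. -/
def pauliX {F : Type*} [Field F] [DecidableEq F] (a : F) : Matrix F F ℂ :=
  Matrix.of fun i j => if i = j + a then 1 else 0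

/-- The generalized Pauli operator `Z^a : |j⟩ ↦ χ(a j) |j⟩`. For `F = ℤ/q` with `q` prime and
`χ j = exp (2 π i j / q)` this is the `a`-th power of the usual clock operator. -/
def pauliZ {F : Type*} [Field F] [DecidableEq F] (χ : AddChar F ℂ) (a : F) : Matrix F F ℂ :=
  Matrix.diagonal fun j => χ (a * j)

/-- The operator `𝒪` on `m` qudits, extended linearly from
`𝒪 |i₁, …, i_m⟩ = Z^{-i₁} ⊗ ⋯ ⊗ Z^{-i_κ} ⊗ X^{i_{κ+1}} ⊗ ⋯ ⊗ X^{i_m} |φ⟩`. -/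
def opO {F : Type*} [Field F] [Fintype F] [DecidableEq F] {m : ℕ} (χ : AddChar F ℂ) (κ : ℕ)
    (φ : QState F m) (ψ : QState F m) : QState F m :=
  fun v => ∑ i : Fin m → F, ψ i *
    localAct (fun j => if (j : ℕ) < κ then pauliZ χ (-(i j)) else pauliX (i j)) φ v

/-- `𝟙 ⊗ L`, where `L` acts on the last `m` of the `r + m` qudits. -/
def actLast {F : Type*} {r m : ℕ} (L : QState F m → QState F m) (ψ : QState F (r + m)) :
    QState F (r + m) :=
  fun v => L (fun w => ψ (Fin.append (fun i => v (Fin.castAdd m i)) w))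
    (fun j => v (Fin.natAdd r j))

/-- The state `|φ_{n,m}⟩ = (𝟙 ⊗ 𝒪) |φ_{n,0}⟩` of `n = r + m` qudits, where `|φ_{n,0}⟩` is the
code state of `C` and `𝒪` is built from the code state `|φ_{m,0}⟩` of a `κ`-dimensional
code `D`. -/
def hierState {F : Type*} [Field F] [Fintype F] [DecidableEq F] {r m : ℕ} (χ : AddChar F ℂ)
    (κ : ℕ) (C : Submodule F (Fin (r + m) → F)) (D : Submodule F (Fin m → F)) :
    QState F (r + m) :=
  actLast (opO χ κ (codeState D)) (codeState C)

end


/-!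
Translating a code state by a codeword leaves its amplitudes unchanged, and translating
`|φ_{n,2}⟩` by a word of its support multiplies them by phases. As a codeword of `C` can be
prescribed on any `k` coordinates, this makes the diagonal of each reduced density matrix on at most
`k` qudits constant. An off-diagonal entry comes from two words of the support that differ only on
these qudits: in `C` there are none, and for `|φ_{n,2}⟩` a translation that fixes the entry
multiplies it by a nontrivial value of `χ`, so it vanishes.

Suppose that invertible local operators `M₁, …, Mₙ` take `|φ_{n,0}⟩` to `|φ_{n,2}⟩`. The words in
the support of `|φ_{n,2}⟩` restrict on the first `n - 2` positions to a punctured MDS code, so two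
of them that agree on `k` of these positions agree on all of them; this forces each column of
`M_j`, `j ≤ n - 2`, to have a single nonzero entry, so that `M_j` is monomial. Projecting the first
`n - 2` qudits onto `|0, …, 0⟩` then picks out a single codeword of `C` and leaves a product state
on the last two qudits. On the other side, it leaves `|φ_{2,0}⟩`, which is entangled.
-/

open scoped ComplexConjugate

section InvertibleMatrices

variable {ι R : Type*} [Fintype ι] [DecidableEq ι] [Semiring R] [Nontrivial R] {M : Matrix ι ι R}

theorem exists_row_apply_ne_zero_of_isUnit (hM : IsUnit M) (i : ι) : ∃ j, M i j ≠ 0 := by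
  obtain ⟨U, rfl⟩ := hM
  by_contra! hrow
  simpa [Matrix.mul_apply, hrow] using congrFun₂ U.mul_inv i i

theorem exists_col_apply_ne_zero_of_isUnit (hM : IsUnit M) (j : ι) : ∃ i, M i j ≠ 0 := by
  obtain ⟨U, rfl⟩ := hM
  by_contra! hcol
  simpa [Matrix.mul_apply, hcol] using congrFun₂ U.inv_mul j j

theorem support_row_subsingleton_of_support_col_subsingleton (hM : IsUnit M)
    (hcol : ∀ j, (Function.support fun i => M i j).Subsingleton) (i : ι) :
    (Function.support (M i)).Subsingleton := by
  choose f hf using exists_col_apply_ne_zero_of_isUnit hM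
  have hf_eq {i j : ι} (h : M i j ≠ 0) : f j = i := hcol j (hf j) h
  have hf_inj : f.Injective := Finite.injective_iff_surjective.2 fun i =>
    (exists_row_apply_ne_zero_of_isUnit hM i).imp fun _ => hf_eq
  exact fun j hj j' hj' => hf_inj ((hf_eq hj).trans (hf_eq hj').symm)

end InvertibleMatrices

section LocalOperators

variable {F : Type*} [Fintype F] {n : ℕ} {M : Fin n → Matrix F F ℂ} {ψ : QState F n}

theorem localAct_localAct (N M : Fin n → Matrix F F ℂ) (ψ : QState F n) :
    localAct N (localAct M ψ) = localAct (fun i => N i * M i) ψ := by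
  classical
  funext v
  simp only [localAct, Matrix.mul_apply, Finset.mul_sum]
  rw [Finset.sum_comm]
  refine Finset.sum_congr rfl fun w _ => ?_
  rw [Finset.prod_univ_sum, Fintype.piFinset_univ, Finset.sum_mul]
  refine Finset.sum_congr rfl fun u _ => ?_
  rw [Finset.prod_mul_distrib, mul_assoc]

theorem exists_of_localAct_ne_zero {v : Fin n → F} (hv : localAct M ψ v ≠ 0) :
    ∃ w, ψ w ≠ 0 ∧ ∀ i, M i (v i) (w i) ≠ 0 := by
  obtain ⟨w, -, hw⟩ := Finset.exists_ne_zero_of_sum_ne_zero hv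
  exact ⟨w, right_ne_zero_of_mul hw,
    fun i => Finset.prod_ne_zero_iff.1 (left_ne_zero_of_mul hw) i (Finset.mem_univ i)⟩

theorem localAct_apply_eq_of_unique {v c : Fin n → F}
    (h : ∀ d, ψ d ≠ 0 → (∀ i, M i (v i) (d i) ≠ 0) → d = c) :
    localAct M ψ v = (∏ i, M i (v i) (c i)) * ψ c := by
  refine Finset.sum_eq_single c (fun d _ hdc => ?_) (by simp)
  by_contra hd
  exact hdc <| h d (right_ne_zero_of_mul hd) fun i =>
    Finset.prod_ne_zero_iff.1 (left_ne_zero_of_mul hd) i (Finset.mem_univ i)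

variable [DecidableEq F]

theorem exists_localAct_ne_zero_and_eqOn (hM : ∀ i, IsUnit (M i)) {S : Finset (Fin n)}
    (hψ : ∀ c d, ψ c ≠ 0 → ψ d ≠ 0 → (∀ i ∉ S, c i = d i) → c = d)
    {c v : Fin n → F} (hc : ψ c ≠ 0) (hv : ∀ i ∈ S, M i (v i) (c i) ≠ 0) :
    ∃ w, localAct M ψ w ≠ 0 ∧ ∀ i ∈ S, w i = v i := by
  -- Undoing `M` off `S` leaves a state whose coefficient at `u` comes from `c` alone.
  let N : Fin n → Matrix F F ℂ := fun i => if i ∈ S then 1 else (M i)⁻¹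
  let u : Fin n → F := fun i => if i ∈ S then v i else c i
  have hNM_mem {i} (hi : i ∈ S) : N i * M i = M i := by simp [N, hi]
  have hNM_notMem {i} (hi : i ∉ S) : N i * M i = 1 := by
    simp [N, hi, Matrix.nonsing_inv_mul _ ((Matrix.isUnit_iff_isUnit_det _).1 (hM i))]
  have hcoeff : localAct N (localAct M ψ) u = (∏ i, (N i * M i) (u i) (c i)) * ψ c := by
    rw [localAct_localAct]
    refine localAct_apply_eq_of_unique fun d hd hdu => hψ d c hd hc fun i hi => ?_
    simpa [hNM_notMem hi, Matrix.one_apply, u, hi, eq_comm] using hdu i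
  have hne : localAct N (localAct M ψ) u ≠ 0 := by
    rw [hcoeff]
    refine mul_ne_zero (Finset.prod_ne_zero_iff.2 fun i _ => ?_) hc
    by_cases hi : i ∈ S
    · simpa [hNM_mem hi, u, hi] using hv i hi
    · simp [hNM_notMem hi, u, hi]
  obtain ⟨w, hw, hNw⟩ := exists_of_localAct_ne_zero hne
  exact ⟨w, hw, fun i hi => by simpa [N, Matrix.one_apply, u, hi, eq_comm] using hNw i⟩

theorem support_col_subsingleton_of_localAct (hM : ∀ i, IsUnit (M i)) {S : Finset (Fin n)}
    {j : Fin n} (hj : j ∈ S)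
    (hψ : ∀ c d, ψ c ≠ 0 → ψ d ≠ 0 → (∀ i ∉ S, c i = d i) → c = d)
    (hMψ : ∀ w w', localAct M ψ w ≠ 0 → localAct M ψ w' ≠ 0 →
      (∀ i ∈ S.erase j, w i = w' i) → w j = w' j)
    {c : Fin n → F} (hc : ψ c ≠ 0) : (Function.support fun b => M j b (c j)).Subsingleton := by
  choose v hv using fun i => exists_col_apply_ne_zero_of_isUnit (hM i) (c i)
  have exists_lift {b : F} (hb : M j b (c j) ≠ 0) :
      ∃ w, localAct M ψ w ≠ 0 ∧ ∀ i ∈ S, w i = Function.update v j b i := by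
    refine exists_localAct_ne_zero_and_eqOn hM hψ hc fun i _ => ?_
    obtain rfl | hij := eq_or_ne i j
    · rwa [Function.update_self]
    · rw [Function.update_of_ne hij]
      exact hv i
  intro b hb b' hb'
  obtain ⟨w, hw, hwS⟩ := exists_lift hb
  obtain ⟨w', hw', hwS'⟩ := exists_lift hb'
  have hww' : w j = w' j := hMψ w w' hw hw' fun i hi => by
    obtain ⟨hij, hiS⟩ := Finset.mem_erase.1 hi
    rw [hwS i hiS, hwS' i hiS, Function.update_of_ne hij, Function.update_of_ne hij]
  simpa [hwS j hj, hwS' j hj] using hww'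

end LocalOperators

theorem exists_localAct_append_eq_mul_prod {F : Type*} [Fintype F] {r m : ℕ}
    {M : Fin (r + m) → Matrix F F ℂ} {ψ : QState F (r + m)} {a : Fin r → F}
    (hψ : ∀ c d, ψ c ≠ 0 → ψ d ≠ 0 →
      (∀ i : Fin r, c (Fin.castAdd m i) = d (Fin.castAdd m i)) → c = d)
    (hM : ∀ i : Fin r, (Function.support (M (Fin.castAdd m i) (a i))).Subsingleton) :
    ∃ (z : ℂ) (f : Fin m → F → ℂ), ∀ w,
      localAct M ψ (Fin.append a w) = z * ∏ j, f j (w j) := by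
  by_cases hex : ∃ c, ψ c ≠ 0 ∧ ∀ i : Fin r, M (Fin.castAdd m i) (a i) (c (Fin.castAdd m i)) ≠ 0
  · obtain ⟨c, hc, hMc⟩ := hex
    refine ⟨ψ c * ∏ i : Fin r, M (Fin.castAdd m i) (a i) (c (Fin.castAdd m i)),
      fun j y => M (Fin.natAdd r j) y (c (Fin.natAdd r j)), fun w => ?_⟩
    rw [localAct_apply_eq_of_unique (c := c) fun d hd hMd => hψ d c hd hc fun i => hM i
      (by simpa using hMd (Fin.castAdd m i)) (hMc i), Fin.prod_univ_add]
    simp only [Fin.append_left, Fin.append_right]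
    ring
  · refine ⟨0, 0, fun w => ?_⟩
    rw [zero_mul]
    by_contra hw
    obtain ⟨c, hc, hMc⟩ := exists_of_localAct_ne_zero hw
    exact hex ⟨c, hc, fun i => by simpa using hMc (Fin.castAdd m i)⟩

section Uniformity

section Glue

variable {F : Type*} {n : ℕ} {S : Finset (Fin n)}

/-- The word equal to `a` on `S` and to `w` off `S`, the index of the amplitudes in the definition
of `reducedDensity`. -/
def glue (S : Finset (Fin n)) (a : {i // i ∈ S} → F) (w : {i // i ∉ S} → F) : Fin n → F :=
  (Equiv.piEquivPiSubtypeProd (fun i => i ∈ S) (fun _ => F)).symm (a, w)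

theorem glue_apply_of_mem (a : {i // i ∈ S} → F) (w : {i // i ∉ S} → F) {i : Fin n}
    (hi : i ∈ S) : glue S a w i = a ⟨i, hi⟩ := by
  simp [glue, Equiv.piEquivPiSubtypeProd, hi]

theorem glue_apply_of_notMem (a : {i // i ∈ S} → F) (w : {i // i ∉ S} → F) {i : Fin n}
    (hi : i ∉ S) : glue S a w i = w ⟨i, hi⟩ := by
  simp [glue, Equiv.piEquivPiSubtypeProd, hi]

theorem glue_left_injective (w : {i // i ∉ S} → F) : (fun a => glue S a w).Injective :=
  fun _ _ h => (Prod.mk.inj ((Equiv.piEquivPiSubtypeProd _ _).symm.injective h)).1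

variable [AddCommGroup F]

theorem glue_add (t : Fin n → F) (a : {i // i ∈ S} → F) (w : {i // i ∉ S} → F) :
    glue S a w + t = glue S (a + S.restrict t) (w + fun i : {i // i ∉ S} => t i) := by
  funext i
  by_cases hi : i ∈ S
  · simp [glue_apply_of_mem _ _ hi]
  · simp [glue_apply_of_notMem _ _ hi]

theorem glue_sub_glue (a b : {i // i ∈ S} → F) (w w' : {i // i ∉ S} → F) :
    glue S a w - glue S b w = glue S a w' - glue S b w' := by
  funext i
  by_cases hi : i ∈ S
  · simp [glue_apply_of_mem _ _ hi]
  · simp [glue_apply_of_notMem _ _ hi]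

end Glue

variable {F : Type*} [Fintype F] {n k : ℕ} {S : Finset (Fin n)}

theorem reducedDensity_apply (ψ : QState F n) (a b : {i // i ∈ S} → F) :
    reducedDensity ψ S a b = ∑ w, ψ (glue S a w) * conj (ψ (glue S b w)) :=
  rfl

variable [AddCommGroup F] {ψ : QState F n}

theorem reducedDensity_add_restrict (ψ : QState F n) (t : Fin n → F) (a b : {i // i ∈ S} → F) :
    reducedDensity ψ S (a + S.restrict t) (b + S.restrict t) =
      ∑ w, ψ (glue S a w + t) * conj (ψ (glue S b w + t)) := by
  simp only [glue_add]
  exact (Equiv.sum_comp (Equiv.addRight fun i : {i // i ∉ S} => t i) _).symm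

theorem reducedDensity_add_restrict_self {t : Fin n → F} (ht : ∀ u, ‖ψ (u + t)‖ = ‖ψ u‖)
    (a : {i // i ∈ S} → F) :
    reducedDensity ψ S (a + S.restrict t) (a + S.restrict t) = reducedDensity ψ S a a := by
  rw [reducedDensity_add_restrict]
  simp only [reducedDensity_apply, Complex.mul_conj', ht]

theorem reducedDensity_eq_zero_of_phase {t : Fin n → F} {z : ℂ} (hz : z ≠ 1)
    (ht : ∀ i ∈ S, t i = 0) {a b : {i // i ∈ S} → F}
    (hψ : ∀ w, ψ (glue S a w + t) * conj (ψ (glue S b w + t)) =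
      z * (ψ (glue S a w) * conj (ψ (glue S b w)))) :
    reducedDensity ψ S a b = 0 := by
  have hfix : reducedDensity ψ S a b = z * reducedDensity ψ S a b := by
    have ht0 : S.restrict t = 0 := funext fun i => ht i i.2
    have htrans := reducedDensity_add_restrict ψ t a b
    rwa [ht0, add_zero, add_zero, Finset.sum_congr rfl fun w _ => hψ w, ← Finset.mul_sum,
      ← reducedDensity_apply] at htrans
  by_contra hne
  exact hz (mul_right_cancel₀ hne (hfix.symm.trans (one_mul _).symm))

variable [DecidableEq F]

/-- The hypotheses are translation symmetries: those of the modulus make the diagonal of each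
reduced density matrix constant, those up to a phase kill its off-diagonal entries. -/
theorem isKUniform_of_translations (hψ : ψ ≠ 0)
    (hnorm : ∀ S : Finset (Fin n), S.card ≤ k → ∀ a : Fin n → F, ∃ t : Fin n → F,
      (∀ i ∈ S, t i = a i) ∧ ∀ u, ‖ψ (u + t)‖ = ‖ψ u‖)
    (hphase : ∀ S : Finset (Fin n), S.card ≤ k → ∀ u v : Fin n → F, u ≠ v →
      (∀ i ∉ S, u i = v i) → ψ u ≠ 0 → ψ v ≠ 0 → ∃ (t : Fin n → F) (z : ℂ), z ≠ 1 ∧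
        (∀ i ∈ S, t i = 0) ∧ ∀ u' v', u' - v' = u - v →
          ψ (u' + t) * conj (ψ (v' + t)) = z * (ψ u' * conj (ψ v'))) :
    IsKUniform k ψ := by
  refine ⟨hψ, fun S hS => ⟨reducedDensity ψ S 0 0, ?_⟩⟩
  ext a b
  rw [Matrix.smul_apply, Matrix.one_apply, smul_eq_mul, mul_ite, mul_one, mul_zero]
  split_ifs with hab
  · subst hab
    obtain ⟨t, hta, ht⟩ := hnorm S hS (glue S a 0)
    have ha : a = 0 + S.restrict t := funext fun i => by
      simp [hta i i.2, glue_apply_of_mem a 0 i.2]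
    rw [ha, reducedDensity_add_restrict_self ht]
  · by_contra hne
    obtain ⟨w, -, hw⟩ := Finset.exists_ne_zero_of_sum_ne_zero hne
    obtain ⟨t, z, hz, ht, htz⟩ := hphase S hS (glue S a w) (glue S b w)
      ((glue_left_injective w).ne hab)
      (fun i hi => by rw [glue_apply_of_notMem a w hi, glue_apply_of_notMem b w hi])
      (left_ne_zero_of_mul hw) (star_ne_zero.1 (right_ne_zero_of_mul hw))
    exact hne (reducedDensity_eq_zero_of_phase hz ht fun w' => htz _ _ (glue_sub_glue a b w' w))

end Uniformity

section CodeStates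

variable {F : Type*} [Field F] {n k : ℕ} {C : Submodule F (Fin n → F)}

@[simp]
theorem codeState_ne_zero_iff {c : Fin n → F} : codeState C c ≠ 0 ↔ c ∈ C := by
  simp [codeState]

theorem codeState_apply_of_mem {c : Fin n → F} (hc : c ∈ C) : codeState C c = 1 :=
  Set.indicator_of_mem hc _

theorem codeState_apply_of_notMem {c : Fin n → F} (hc : c ∉ C) : codeState C c = 0 :=
  Set.indicator_of_notMem hc _

theorem codeState_add {c t : Fin n → F} (ht : t ∈ C) : codeState C (c + t) = codeState C c :=
  Set.indicator_eq_indicator (C.add_mem_iff_left ht) rfl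

variable [DecidableEq F]

theorem IsMDSCode.eq_of_eqOn (hC : IsMDSCode k C) {c d : Fin n → F} (hc : c ∈ C) (hd : d ∈ C)
    {T : Finset (Fin n)} (hT : k ≤ T.card) (h : ∀ i ∈ T, c i = d i) : c = d := by
  by_contra hcd
  have hdist : hammingDist c d ≤ Tᶜ.card := Finset.card_le_card fun i hi => by
    simpa using mt (h i) (Finset.mem_filter.1 hi).2
  have hsum : T.card + Tᶜ.card = n := by rw [Finset.card_add_card_compl, Fintype.card_fin]
  have hmin := hC.2 c hc d hd hcd
  omega

theorem IsMDSCode.eq_of_eqOn_compl (hC : IsMDSCode k C) {c d : Fin n → F} (hc : c ∈ C)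
    (hd : d ∈ C) {S : Finset (Fin n)} (hS : S.card + k ≤ n) (h : ∀ i ∉ S, c i = d i) : c = d :=
  hC.eq_of_eqOn hc hd (T := Sᶜ) (by rw [Finset.card_compl, Fintype.card_fin]; omega)
    fun i hi => h i (Finset.mem_compl.1 hi)

theorem IsMDSCode.eq_of_castAdd_eq {r m : ℕ} {C : Submodule F (Fin (r + m) → F)}
    (hC : IsMDSCode k C) (hk : k ≤ r) {c d : Fin (r + m) → F} (hc : c ∈ C) (hd : d ∈ C)
    (h : ∀ i : Fin r, c (Fin.castAdd m i) = d (Fin.castAdd m i)) : c = d :=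
  hC.eq_of_eqOn hc hd (T := Finset.univ.map (Fin.castAddEmb m)) (by simpa using hk)
    (by simpa using h)

theorem IsMDSCode.exists_eqOn (hC : IsMDSCode k C) {S : Finset (Fin n)} (hS : S.card ≤ k)
    (a : Fin n → F) : ∃ c ∈ C, ∀ i ∈ S, c i = a i := by
  have hkn : k ≤ n := by simpa [hC.1] using Submodule.finrank_le C
  obtain ⟨T, hST, hT⟩ := Finset.exists_superset_card_eq hS (by simpa using hkn)
  let restrictT : C →ₗ[F] (T → F) :=
    LinearMap.funLeft F F (fun i : T => (i : Fin n)) ∘ₗ C.subtype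
  have hinj : Function.Injective restrictT := fun c d hcd =>
    Subtype.ext <| hC.eq_of_eqOn c.2 d.2 hT.ge fun i hi => congrFun hcd ⟨i, hi⟩
  have hsurj : Function.Surjective restrictT :=
    (LinearMap.injective_iff_surjective_of_finrank_eq_finrank (by simp [hC.1, hT])).1 hinj
  obtain ⟨c, hc⟩ := hsurj fun i => a i
  exact ⟨c, c.2, fun i hi => congrFun hc ⟨i, hST hi⟩⟩

theorem IsMDSCode.isKUniform_codeState [Fintype F] (hC : IsMDSCode k C) (hk : 2 * k ≤ n) :
    IsKUniform k (codeState C) := by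
  refine isKUniform_of_translations
    (fun h => codeState_ne_zero_iff.2 C.zero_mem (congrFun h 0)) ?_ ?_
  · intro S hS a
    obtain ⟨c, hc, hca⟩ := hC.exists_eqOn hS a
    exact ⟨c, hca, fun u => by rw [codeState_add hc]⟩
  · intro S hS u v huv huvS hu hv
    rw [codeState_ne_zero_iff] at hu hv
    exact absurd (hC.eq_of_eqOn_compl hu hv (by omega) huvS) huv

end CodeStates

section LineCodes

variable {F : Type*} [Field F] {l : F}

theorem mem_span_one_slope {d : Fin 2 → F} : d ∈ F ∙ ![1, l] ↔ d 1 = l * d 0 := by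
  simp [Submodule.mem_span_singleton, funext_iff, Fin.forall_fin_two, mul_comm, eq_comm]

theorem IsMDSCode.exists_eq_span_one_slope [DecidableEq F] {D : Submodule F (Fin 2 → F)}
    (hD : IsMDSCode 1 D) : ∃ l : F, l ≠ 0 ∧ D = F ∙ ![1, l] := by
  obtain ⟨e, heD, he⟩ := hD.exists_eqOn (S := {0}) (by simp) 1
  have he0 : e 0 = 1 := by simpa using he
  have he1 : e 1 ≠ 0 := fun h => by
    have he_zero : e = 0 := hD.eq_of_eqOn heD D.zero_mem (T := {1}) (by simp) (by simpa using h)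
    simp [he_zero] at he0
  have he_eq : ![1, e 1] = e := by
    ext i
    fin_cases i <;> simp [he0]
  refine ⟨e 1, he1, le_antisymm (fun d hd => ?_) ?_⟩
  · have hde : d = d 0 • e :=
      hD.eq_of_eqOn hd (D.smul_mem _ heD) (T := {0}) (by simp) (by simp [he0])
    exact Submodule.mem_span_singleton.2 ⟨d 0, by rw [he_eq, ← hde]⟩
  · rwa [he_eq, Submodule.span_singleton_le_iff_mem]

theorem codeState_span_one_slope_ne_mul_prod (hl : l ≠ 0) (z : ℂ) (f : Fin 2 → F → ℂ) :
    ¬ ∀ w, codeState (F ∙ ![1, l]) w = z * ∏ j, f j (w j) := by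
  intro h
  simp only [Fin.prod_univ_two] at h
  have h00 := h ![0, 0]
  have h1l := h ![1, l]
  have h0l := h ![0, l]
  rw [codeState_apply_of_mem (mem_span_one_slope.2 (by simp))] at h00 h1l
  rw [codeState_apply_of_notMem (mt mem_span_one_slope.1 (by simpa using hl))] at h0l
  simp only [Matrix.cons_val_zero, Matrix.cons_val_one] at h00 h1l h0l
  have hf00 : z * f 0 0 ≠ 0 := fun h0 => one_ne_zero (h00.trans (by rw [← mul_assoc, h0, zero_mul]))
  have hf1l : f 1 l ≠ 0 := fun h0 => one_ne_zero (h1l.trans (by rw [h0, mul_zero, mul_zero]))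
  exact mul_ne_zero hf00 hf1l (by rw [h0l, mul_assoc])

end LineCodes

section LastTwoCoordinates

variable {F : Type*} {r : ℕ}

theorem forall_fin_add_two {P : Fin (r + 2) → Prop} :
    (∀ i, P i) ↔
      (∀ i : Fin r, P (Fin.castAdd 2 i)) ∧ P (Fin.natAdd r 0) ∧ P (Fin.natAdd r 1) := by
  refine ⟨fun h => ⟨fun _ => h _, h _, h _⟩, fun ⟨hinit, h0, h1⟩ => Fin.addCases hinit ?_⟩
  exact Fin.forall_fin_two.2 ⟨h0, h1⟩

theorem append_eq_iff_two {a : Fin r → F} {w : Fin 2 → F} {v : Fin (r + 2) → F} :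
    Fin.append a w = v ↔ (∀ i, a i = v (Fin.castAdd 2 i)) ∧
      w 0 = v (Fin.natAdd r 0) ∧ w 1 = v (Fin.natAdd r 1) := by
  simp only [funext_iff, forall_fin_add_two, Fin.append_left, Fin.append_right]

end LastTwoCoordinates

section HierarchicalStates

section HierWord

variable {F : Type*} [Field F] {r k : ℕ} {l : F}

/-- The word `(c₁, …, c_r, x, l x + c_{r+2})` attached to the pair `(c, x)`: since
`𝒪 |i₁, i₂⟩ = ∑ₓ χ(-i₁ x) |x, l x + i₂⟩` when `D` is the line of slope `l`, these are the basis
states that occur in `|φ_{n,2}⟩`. -/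
def hierWord (l : F) : (Fin (r + 2) → F) × F →ₗ[F] (Fin (r + 2) → F) where
  toFun p := Fin.append (fun i => p.1 (Fin.castAdd 2 i)) ![p.2, l * p.2 + p.1 (Fin.natAdd r 1)]
  map_add' p p' := by
    rw [append_eq_iff_two]
    simp [mul_add, add_add_add_comm]
  map_smul' s p := by
    rw [append_eq_iff_two]
    simp [mul_add, mul_left_comm]

theorem hierWord_apply (l : F) (p : (Fin (r + 2) → F) × F) :
    hierWord l p =
      Fin.append (fun i => p.1 (Fin.castAdd 2 i)) ![p.2, l * p.2 + p.1 (Fin.natAdd r 1)] :=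
  rfl

@[simp]
theorem hierWord_castAdd (p : (Fin (r + 2) → F) × F) (i : Fin r) :
    hierWord l p (Fin.castAdd 2 i) = p.1 (Fin.castAdd 2 i) := by
  rw [hierWord_apply, Fin.append_left]

@[simp]
theorem hierWord_natAdd_zero (p : (Fin (r + 2) → F) × F) :
    hierWord l p (Fin.natAdd r 0) = p.2 := by
  simp only [hierWord_apply, Fin.append_right, Matrix.cons_val_zero]

@[simp]
theorem hierWord_natAdd_one (p : (Fin (r + 2) → F) × F) :
    hierWord l p (Fin.natAdd r 1) = l * p.2 + p.1 (Fin.natAdd r 1) := by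
  simp only [hierWord_apply, Fin.append_right, Matrix.cons_val_zero, Matrix.cons_val_one]

/-- The linear code formed by the words `hierWord l (c, x)` with `c ∈ C`; for an MDS code `C` it is
the support of `|φ_{n,2}⟩`. -/
def hierCode (l : F) (C : Submodule F (Fin (r + 2) → F)) : Submodule F (Fin (r + 2) → F) :=
  (C.prod ⊤).map (hierWord l)

variable {C : Submodule F (Fin (r + 2) → F)}

theorem mem_hierCode {v : Fin (r + 2) → F} :
    v ∈ hierCode l C ↔ ∃ c ∈ C, ∃ x, hierWord l (c, x) = v := by
  simp [hierCode, Submodule.mem_map]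

theorem hierWord_mem_hierCode {c : Fin (r + 2) → F} (hc : c ∈ C) (x : F) :
    hierWord l (c, x) ∈ hierCode l C :=
  mem_hierCode.2 ⟨c, hc, x, rfl⟩

variable [DecidableEq F]

theorem IsMDSCode.eq_zero_of_hierWord (hC : IsMDSCode k C)
    (hr : 2 * k ≤ r + 1) {c : Fin (r + 2) → F} (hc : c ∈ C) {x : F} {S : Finset (Fin (r + 2))}
    (hS : S.card ≤ k) (h : ∀ i ∉ S, hierWord l (c, x) i = 0) : c = 0 := by
  -- One of the last two entries of `c` may be nonzero off `S`, but not both.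
  suffices ∃ j, ∀ i ∉ insert j S, c i = 0 by
    obtain ⟨j, hj⟩ := this
    have hcard := Finset.card_insert_le j S
    exact hC.eq_of_eqOn_compl hc C.zero_mem (by omega) hj
  have hinit (i : Fin r) (hi : Fin.castAdd 2 i ∉ S) : c (Fin.castAdd 2 i) = 0 := by
    simpa using h _ hi
  have h0 : Fin.natAdd r 0 ∉ S → x = 0 := fun hi => by
    simpa only [hierWord_natAdd_zero] using h _ hi
  have h1 : Fin.natAdd r 1 ∉ S → l * x + c (Fin.natAdd r 1) = 0 := fun hi => by
    simpa only [hierWord_natAdd_one] using h _ hi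
  simp only [Finset.mem_insert, not_or, forall_fin_add_two]
  by_cases hx : x = 0
  · exact ⟨Fin.natAdd r 0, fun i hi => hinit i hi.2, fun hi => absurd rfl hi.1,
      fun hi => by simpa [hx] using h1 hi.2⟩
  · exact ⟨Fin.natAdd r 1, fun i hi => hinit i hi.2, fun hi => absurd (h0 hi.2) hx,
      fun hi => absurd rfl hi.1⟩

theorem natAdd_zero_ne_of_mem_hierCode (hC : IsMDSCode k C) (hr : 2 * k ≤ r + 1)
    {S : Finset (Fin (r + 2))} (hS : S.card ≤ k) {u v : Fin (r + 2) → F}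
    (hu : u ∈ hierCode l C) (hv : v ∈ hierCode l C) (huv : u ≠ v) (h : ∀ i ∉ S, u i = v i) :
    u (Fin.natAdd r 0) ≠ v (Fin.natAdd r 0) := by
  obtain ⟨e, he, x, hex⟩ := mem_hierCode.1 ((hierCode l C).sub_mem hu hv)
  have he0 : e = 0 := hC.eq_zero_of_hierWord hr he hS fun i hi => by
    rw [hex, Pi.sub_apply, h i hi, sub_self]
  subst he0
  rw [← sub_ne_zero, ← Pi.sub_apply, ← hex, hierWord_natAdd_zero]
  rintro rfl
  exact huv (sub_eq_zero.1 (hex.symm.trans (map_zero _)))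

theorem exists_mem_hierCode_eqOn (hC : IsMDSCode k C) {S : Finset (Fin (r + 2))}
    (hS : S.card ≤ k) (a : Fin (r + 2) → F) : ∃ t ∈ hierCode l C, ∀ i ∈ S, t i = a i := by
  obtain ⟨c, hc, hca⟩ := hC.exists_eqOn hS
    (Function.update a (Fin.natAdd r 1) (a (Fin.natAdd r 1) - l * a (Fin.natAdd r 0)))
  refine ⟨hierWord l (c, a (Fin.natAdd r 0)), hierWord_mem_hierCode hc _, ?_⟩
  rw [forall_fin_add_two]
  refine ⟨fun i hi => ?_, fun _ => hierWord_natAdd_zero _, fun hi => ?_⟩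
  · simpa [Function.update_apply, Fin.ext_iff, i.2.ne, (Nat.lt_succ_of_lt i.2).ne] using hca _ hi
  · have hc1 := (hca _ hi).trans (Function.update_self ..)
    simp only [hierWord_natAdd_one, hc1, add_sub_cancel]

theorem castAdd_eq_of_mem_hierCode (hC : IsMDSCode k C) {T : Finset (Fin r)} (hT : k ≤ T.card)
    {u v : Fin (r + 2) → F} (hu : u ∈ hierCode l C) (hv : v ∈ hierCode l C)
    (h : ∀ i ∈ T, u (Fin.castAdd 2 i) = v (Fin.castAdd 2 i)) (j : Fin r) :
    u (Fin.castAdd 2 j) = v (Fin.castAdd 2 j) := by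
  obtain ⟨c, hc, x, rfl⟩ := mem_hierCode.1 hu
  obtain ⟨d, hd, y, rfl⟩ := mem_hierCode.1 hv
  have hcd : c = d := hC.eq_of_eqOn hc hd (T := T.map (Fin.castAddEmb 2))
    (by rwa [Finset.card_map]) (by simpa using h)
  rw [hierWord_castAdd, hierWord_castAdd, hcd]

end HierWord

variable {F : Type*} [Field F] [Fintype F] [DecidableEq F] {r k : ℕ} {l : F} {χ : AddChar F ℂ}
  {C : Submodule F (Fin (r + 2) → F)}

theorem localAct_pauli {m : ℕ} (χ : AddChar F ℂ) (κ : ℕ) (i : Fin m → F) (φ : QState F m)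
    (v : Fin m → F) :
    localAct (fun j => if (j : ℕ) < κ then pauliZ χ (-(i j)) else pauliX (i j)) φ v =
      (∏ j : Fin m, if (j : ℕ) < κ then χ (-(i j) * v j) else 1) *
        φ fun j => if (j : ℕ) < κ then v j else v j - i j := by
  rw [localAct_apply_eq_of_unique fun d _ hd => funext fun j => ?_]
  · congr 1
    refine Finset.prod_congr rfl fun j _ => ?_
    split_ifs <;> simp [pauliZ, pauliX]
  · have hdj := hd j
    split_ifs at hdj ⊢
    · exact (ite_ne_right_iff.1 hdj).1.symm
    · simpa [pauliX, eq_sub_iff_add_eq, eq_comm] using hdj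

theorem hierState_apply (χ : AddChar F ℂ) (C : Submodule F (Fin (r + 2) → F)) (l : F)
    (v : Fin (r + 2) → F) :
    hierState χ 1 C (F ∙ ![1, l]) v = ∑ i : Fin 2 → F,
      codeState C (Fin.append (fun j => v (Fin.castAdd 2 j)) i) *
        if v (Fin.natAdd r 1) = l * v (Fin.natAdd r 0) + i 1 then
          χ (-(i 0) * v (Fin.natAdd r 0)) else 0 := by
  simp only [hierState, actLast, opO, localAct_pauli]
  refine Finset.sum_congr rfl fun i _ => ?_
  simp only [Fin.prod_univ_two, codeState, Set.indicator, SetLike.mem_coe, mem_span_one_slope]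
  simp [sub_eq_iff_eq_add]

theorem mem_hierCode_of_hierState_ne_zero {v : Fin (r + 2) → F}
    (hv : hierState χ 1 C (F ∙ ![1, l]) v ≠ 0) : v ∈ hierCode l C := by
  rw [hierState_apply] at hv
  obtain ⟨i, -, hi⟩ := Finset.exists_ne_zero_of_sum_ne_zero hv
  have hvi := (ite_ne_right_iff.1 (right_ne_zero_of_mul hi)).1
  refine mem_hierCode.2 ⟨_, codeState_ne_zero_iff.1 (left_ne_zero_of_mul hi),
    v (Fin.natAdd r 0), ?_⟩
  rw [hierWord_apply, append_eq_iff_two]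
  simp only [Fin.append_left, Fin.append_right, hvi]
  simp

theorem hierState_hierWord (hC : IsMDSCode k C) (hk : k ≤ r + 1) {c : Fin (r + 2) → F}
    (hc : c ∈ C) (x : F) :
    hierState χ 1 C (F ∙ ![1, l]) (hierWord l (c, x)) = χ (-(c (Fin.natAdd r 0)) * x) := by
  have happend : Fin.append (fun j => c (Fin.castAdd 2 j)) (fun j => c (Fin.natAdd r j)) = c :=
    Fin.append_castAdd_natAdd
  rw [hierState_apply]
  simp only [hierWord_castAdd, hierWord_natAdd_zero, hierWord_natAdd_one, add_right_inj]
  rw [Finset.sum_eq_single fun j => c (Fin.natAdd r j)]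
  · rw [happend, codeState_apply_of_mem hc, one_mul, if_pos rfl]
  · intro i _ hic
    by_contra hi
    have hi1 := (ite_ne_right_iff.1 (right_ne_zero_of_mul hi)).1
    -- The two codewords differ in a single position.
    have heq := hC.eq_of_eqOn_compl (codeState_ne_zero_iff.1 (left_ne_zero_of_mul hi)) hc
      (S := {Fin.natAdd r 0}) (by rw [Finset.card_singleton]; omega) (by
        simp [forall_fin_add_two, hi1])
    exact hic (funext fun j => by rw [← heq, Fin.append_right])
  · simp

theorem hierState_ne_zero_iff (hC : IsMDSCode k C) (hk : k ≤ r + 1) {v : Fin (r + 2) → F} :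
    hierState χ 1 C (F ∙ ![1, l]) v ≠ 0 ↔ v ∈ hierCode l C := by
  refine ⟨mem_hierCode_of_hierState_ne_zero, fun hv => ?_⟩
  obtain ⟨c, hc, x, rfl⟩ := mem_hierCode.1 hv
  rw [hierState_hierWord hC hk hc]
  exact (χ.val_isUnit _).ne_zero

theorem norm_hierState (hC : IsMDSCode k C) (hk : k ≤ r + 1) (v : Fin (r + 2) → F) :
    ‖hierState χ 1 C (F ∙ ![1, l]) v‖ = (hierCode l C : Set (Fin (r + 2) → F)).indicator 1 v := by
  by_cases hv : v ∈ hierCode l C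
  · rw [Set.indicator_of_mem hv]
    obtain ⟨c, hc, x, rfl⟩ := mem_hierCode.1 hv
    rw [hierState_hierWord hC hk hc, χ.norm_apply, Pi.one_apply]
  · rw [Set.indicator_of_notMem hv, norm_eq_zero]
    exact not_ne_iff.1 (mt mem_hierCode_of_hierState_ne_zero hv)

theorem norm_hierState_add (hC : IsMDSCode k C) (hk : k ≤ r + 1) {t : Fin (r + 2) → F}
    (ht : t ∈ hierCode l C) (v : Fin (r + 2) → F) :
    ‖hierState χ 1 C (F ∙ ![1, l]) (v + t)‖ = ‖hierState χ 1 C (F ∙ ![1, l]) v‖ := by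
  rw [norm_hierState hC hk, norm_hierState hC hk]
  exact Set.indicator_eq_indicator ((hierCode l C).add_mem_iff_left ht) rfl

theorem hierState_add_hierWord_zero (hC : IsMDSCode k C) (hk : k ≤ r + 1) {e : Fin (r + 2) → F}
    (he : e ∈ C) (v : Fin (r + 2) → F) :
    hierState χ 1 C (F ∙ ![1, l]) (v + hierWord l (e, 0)) =
      χ (-(e (Fin.natAdd r 0)) * v (Fin.natAdd r 0)) * hierState χ 1 C (F ∙ ![1, l]) v := by
  by_cases hv : v ∈ hierCode l C
  · obtain ⟨c, hc, x, rfl⟩ := mem_hierCode.1 hv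
    rw [← map_add, Prod.mk_add_mk, hierState_hierWord hC hk (C.add_mem hc he),
      hierState_hierWord hC hk hc, hierWord_natAdd_zero, ← χ.map_add_eq_mul, Pi.add_apply]
    congr 1
    ring
  · have hvt := mt ((hierCode l C).add_mem_iff_left (hierWord_mem_hierCode he 0)).1 hv
    rw [← hierState_ne_zero_iff (χ := χ) hC hk, not_ne_iff] at hv hvt
    rw [hv, hvt, mul_zero]

theorem hierState_add_hierWord_zero_mul_conj (hC : IsMDSCode k C) (hk : k ≤ r + 1)
    {e : Fin (r + 2) → F} (he : e ∈ C) (u v : Fin (r + 2) → F) :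
    hierState χ 1 C (F ∙ ![1, l]) (u + hierWord l (e, 0)) *
        conj (hierState χ 1 C (F ∙ ![1, l]) (v + hierWord l (e, 0))) =
      χ (-(e (Fin.natAdd r 0)) * (u - v) (Fin.natAdd r 0)) *
        (hierState χ 1 C (F ∙ ![1, l]) u * conj (hierState χ 1 C (F ∙ ![1, l]) v)) := by
  have hχ_sub : χ (-(e (Fin.natAdd r 0)) * (u - v) (Fin.natAdd r 0)) =
      χ (-(e (Fin.natAdd r 0)) * u (Fin.natAdd r 0)) *
        conj (χ (-(e (Fin.natAdd r 0)) * v (Fin.natAdd r 0))) := by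
    rw [← χ.map_neg_eq_conj, ← χ.map_add_eq_mul, Pi.sub_apply, mul_sub, sub_eq_add_neg]
  rw [hierState_add_hierWord_zero hC hk he, hierState_add_hierWord_zero hC hk he, hχ_sub,
    RingHom.map_mul, mul_mul_mul_comm]

theorem isKUniform_hierState (hχ : χ ≠ 1) (hC : IsMDSCode k C) (hr : 2 * k ≤ r + 1) :
    IsKUniform k (hierState χ 1 C (F ∙ ![1, l])) := by
  have hk : k ≤ r + 1 := by omega
  refine isKUniform_of_translations
    (fun h => (hierState_ne_zero_iff hC hk).2 (hierCode l C).zero_mem (congrFun h 0)) ?_ ?_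
  · intro S hS a
    obtain ⟨t, ht, hta⟩ := exists_mem_hierCode_eqOn (l := l) hC hS a
    exact ⟨t, hta, norm_hierState_add hC hk ht⟩
  · intro S hS u v huv huvS hu hv
    rw [hierState_ne_zero_iff hC hk] at hu hv
    have hne := natAdd_zero_ne_of_mem_hierCode hC hr hS hu hv huv huvS
    have hlast : Fin.natAdd r 0 ∈ S := not_not.1 (mt (huvS _) hne)
    have hsub : (u - v) (Fin.natAdd r 0) ≠ 0 := sub_ne_zero.2 hne
    obtain ⟨s, hs⟩ := AddChar.ne_one_iff.1 hχ
    obtain ⟨e, he, hes⟩ := hC.exists_eqOn hS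
      (Pi.single (Fin.natAdd r 0) (-(s / (u - v) (Fin.natAdd r 0))))
    refine ⟨hierWord l (e, 0), χ s, hs, ?_, fun u' v' hsub' => ?_⟩
    · refine forall_fin_add_two.2 ⟨fun i hi => ?_, fun _ => hierWord_natAdd_zero _, fun hi => ?_⟩
      · simpa [Pi.single_apply, Fin.ext_iff, i.2.ne] using hes _ hi
      · simpa [Pi.single_apply, Fin.ext_iff] using hes _ hi
    · rw [hierState_add_hierWord_zero_mul_conj hC hk he, hsub', hes _ hlast, Pi.single_eq_same,
        neg_neg, div_mul_cancel₀ _ hsub]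

theorem hierState_append_zero (hC : IsMDSCode k C) (hk : k ≤ r) (w : Fin 2 → F) :
    hierState χ 1 C (F ∙ ![1, l]) (Fin.append 0 w) = codeState (F ∙ ![1, l]) w := by
  by_cases hw : w ∈ F ∙ ![1, l]
  · have hword : Fin.append (0 : Fin r → F) w = hierWord l (0, w 0) := by
      rw [append_eq_iff_two]
      simpa using mem_span_one_slope.1 hw
    rw [hword, hierState_hierWord hC (by omega) C.zero_mem, codeState_apply_of_mem hw,
      Pi.zero_apply, neg_zero, zero_mul, χ.map_zero_eq_one]
  · rw [codeState_apply_of_notMem hw]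
    refine not_ne_iff.1 (mt mem_hierCode_of_hierState_ne_zero fun hmem => hw ?_)
    obtain ⟨c, hc, x, hcx⟩ := mem_hierCode.1 hmem
    obtain ⟨hinit, h0, h1⟩ := append_eq_iff_two.1 hcx.symm
    have hc0 : c = 0 := hC.eq_of_castAdd_eq hk hc C.zero_mem fun i => by
      simpa using (hinit i).symm
    simp only [mem_span_one_slope, h0, h1, hierWord_natAdd_zero, hierWord_natAdd_one, hc0,
      Pi.zero_apply, add_zero]

theorem support_col_subsingleton_of_localAct_codeState (hC : IsMDSCode k C) (hk : 1 ≤ k)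
    (hkr : k + 1 ≤ r) (hr : 2 * k ≤ r + 1) {M : Fin (r + 2) → Matrix F F ℂ}
    (hM : ∀ i, IsUnit (M i))
    (hMC : localAct M (codeState C) = hierState χ 1 C (F ∙ ![1, l])) (j : Fin r) (a : F) :
    (Function.support fun b => M (Fin.castAdd 2 j) b a).Subsingleton := by
  obtain ⟨T, hjT, hT⟩ := Finset.exists_superset_card_eq (s := {j}) (n := k + 1)
    (by simp) (by simpa using hkr)
  rw [Finset.singleton_subset_iff] at hjT
  obtain ⟨c, hc, hca⟩ := hC.exists_eqOn (S := {Fin.castAdd 2 j}) (by simpa using hk) fun _ => a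
  rw [← hca _ (Finset.mem_singleton_self _)]
  refine support_col_subsingleton_of_localAct hM (S := T.map (Fin.castAddEmb 2))
    (Finset.mem_map_of_mem _ hjT) (fun c d hc hd hcd => ?_) (fun w w' hw hw' hww' => ?_)
    (codeState_ne_zero_iff.2 hc)
  · rw [codeState_ne_zero_iff] at hc hd
    exact hC.eq_of_eqOn_compl hc hd (by rw [Finset.card_map]; omega) hcd
  · rw [hMC] at hw hw'
    refine castAdd_eq_of_mem_hierCode hC (T := T.erase j)
      (by rw [Finset.card_erase_of_mem hjT]; omega) (mem_hierCode_of_hierState_ne_zero hw)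
      (mem_hierCode_of_hierState_ne_zero hw') (fun i hi => hww' _ ?_) j
    simpa using hi

theorem not_sloccEquiv_hierState (hC : IsMDSCode k C) (hk : 1 ≤ k) (hkr : k + 1 ≤ r)
    (hr : 2 * k ≤ r + 1) (hl : l ≠ 0) :
    ¬ SLOCCEquiv (codeState C) (hierState χ 1 C (F ∙ ![1, l])) := by
  rintro ⟨M, hM, hMC⟩
  have hrow (i : Fin r) : (Function.support (M (Fin.castAdd 2 i) 0)).Subsingleton :=
    support_row_subsingleton_of_support_col_subsingleton (hM _)
      (support_col_subsingleton_of_localAct_codeState hC hk hkr hr hM hMC i) 0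
  obtain ⟨z, f, hprod⟩ := exists_localAct_append_eq_mul_prod (a := 0)
    (fun c d hc hd => hC.eq_of_castAdd_eq (by omega) (codeState_ne_zero_iff.1 hc)
      (codeState_ne_zero_iff.1 hd)) hrow
  refine codeState_span_one_slope_ne_mul_prod hl z f fun w => ?_
  rw [← hierState_append_zero (χ := χ) hC (by omega), ← hMC, hprod]

end HierarchicalStates

theorem proposition3_general {F : Type*} [Field F] [Fintype F] [DecidableEq F] {χ : AddChar F ℂ}
    (hχ : χ ≠ 1) {k r : ℕ} (hk : 1 ≤ k) (hkr : k + 1 ≤ r) (hr : 2 * k ≤ r + 1)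
    {C : Submodule F (Fin (r + 2) → F)} (hC : IsMDSCode k C) {D : Submodule F (Fin 2 → F)}
    (hD : IsMDSCode 1 D) :
    IsKUniform k (codeState C) ∧ IsKUniform k (hierState χ 1 C D) ∧
      ¬ SLOCCEquiv (codeState C) (hierState χ 1 C D) := by
  obtain ⟨l, hl, rfl⟩ := hD.exists_eq_span_one_slope
  exact ⟨hC.isKUniform_codeState (by omega), isKUniform_hierState hχ hC hr,
    not_sloccEquiv_hierState hC hk hkr hr hl⟩

/-- Here `n = r + 2 = 2 k + 1` is the number of qudits, `C` the MDS code defining `|φ_{n,0}⟩` and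
`D` the MDS code of length two defining `|φ_{2,0}⟩`, for instance the repetition code. -/
theorem proposition3 {F : Type*} [Field F] [Fintype F] [DecidableEq F]
    (χ : AddChar F ℂ) (hχ : χ ≠ 1) (k r : ℕ) (hk : 2 ≤ k) (hr : r + 2 = 2 * k + 1)
    (C : Submodule F (Fin (r + 2) → F)) (hC : IsMDSCode k C)
    (D : Submodule F (Fin 2 → F)) (hD : IsMDSCode 1 D) :
    IsAME (codeState C) ∧ IsAME (hierState χ 1 C D) ∧
      ¬ SLOCCEquiv (codeState C) (hierState χ 1 C D) := by
  have hhalf : (r + 2) / 2 = k := by omega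
  simpa only [IsAME, hhalf] using
    proposition3_general hχ (by omega) (by omega) (by omega) hC hD
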